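/- Let $\Omega\subset\mathbb R^n$ be open (for instance a bounded domain with smooth boundary) and let $\omega\subset\Omega$ be a nonempty open subset; all function spaces are real. Let $H_0^1(\Omega)$ be the closure of $C_c^\infty(\Omega)$ in $H^1(\Omega)$, with norm $\|y\|_{H_0^1}^2=\|\nabla y\|_{L^2(\Omega)}^2+\|y\|_{L^2(\Omega)}^2$, and let $\mathscr A\phi=-\Delta\phi$ with domain $D(\mathscr A)=\{\phi\in H_0^1(\Omega):\Delta\phi\in L^2(\Omega)\}$ be the Dirichlet Laplacian on $L^2(\Omega)$. Let $(e_i)_{i\ge1}\subset D(\mathscr A)$ be an orthonormal basis of $L^2(\Omega)$ consisting of eigenfunctions, $-\Delta e_i=\tau_i e_i$, with $\tau_1\le\tau_2\le\dots$ and $\tau_i\to\infty$. Let $\lambda>0$, $N=\#\{i:\tau_i\le\lambda\}$, $P_Ny=\sum_{i=1}^N(y,e_i)_{L^2(\Omega)}e_i$ and $P_N^\perp y=y-P_Ny$. Let $C_\lambda>0$ be a constant in the spectral inequality $$\Big\|\sum_{i=1}^N a_ie_i\Big\|_{L^2(\omega)}^2\ \ge\ C_\lambda\sum_{i=1}^N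 a_i^2\qquad\text{for all }(a_1,\dots,a_N)\in\mathbb R^N,$$ let $D>0$, and put $\gamma_\lambda=\lambda/C_\lambda$, $\mu=C_\lambda^{-2}$, $\mathscr Cy=\mu P_Ny+P_N^\perp y$ and $$(u,v)_\mu=\mu\,(P_Nu,P_Nv)_{L^2(\Omega)}+(P_N^\perp u,P_N^\perp v)_{L^2(\Omega)}.$$ For $f\in L^2(\Omega)$ let $\operatorname{sign}_{L^2}(f)=\{f/\|f\|_{L^2(\Omega)}\}$ if $f\neq0$, and let $\operatorname{sign}_{L^2}(0)$ be the closed unit ball of $L^2(\Omega)$. Consider the multivalued operator $$Ay=-\Delta y+\gamma_\lambda\chi_\omega P_Ny+\chi_\omega D\operatorname{sign}_{L^2}(\chi_\omega\mathscr Cy),\qquad D(A)=D(\mathscr A).$$ Then $A$ is monotone for $(\cdot,\cdot)_\mu$: for all $y_1,y_2\in D(A)$, $w_1\in Ay_1$, $w_2\in Ay_2$, $$(w_1-w_2,\;y_1-y_2)_\mu\ \ge\ 0 .$$ Moreover its linear part $A_1y=-\Delta y+\gamma_\lambda\chi_\omega P_Ny$ is coercive in $H_0^1$: for all $y\in D(\mathscr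 A)$, $$(A_1y,y)_\mu\ \ge\ c\,\|y\|_{H_0^1}^2,\qquad c=\min\Big\{\tfrac12,\ \tfrac{\lambda}{C_\lambda^2}\big(1-\tfrac{\sqrt2}{2}\big),\ \tfrac{\lambda}{2}\big(1-\tfrac{\sqrt2}{2}\big)\Big\}>0 .$$ -/

import Mathlib

open MeasureTheory TopologicalSpace Set
open scoped Distributions

noncomputable section

namespace HeatFeedback

variable {n : ℕ}

/-- The real Hilbert space `L²(Ω)` for an open set `Ω ⊆ ℝⁿ` with Lebesgue measure. -/
abbrev L2 (Ω : Opens (EuclideanSpace ℝ (Fin n))) : Type :=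
  Lp ℝ 2 (volume.restrict (Ω : Set (EuclideanSpace ℝ (Fin n))))

/-- The classical partial derivative `∂ᵢ φ`. -/
def partialDeriv (i : Fin n) (φ : EuclideanSpace ℝ (Fin n) → ℝ) (x : EuclideanSpace ℝ (Fin n)) :
    ℝ :=
  fderiv ℝ φ x (EuclideanSpace.single i 1)

/-- `g = (g₁, …, gₙ)` is the weak gradient of `u` in `Ω`; here `𝓓(Ω, ℝ)` is `C_c^∞(Ω)`. -/
def HasWeakGradient {Ω : Opens (EuclideanSpace ℝ (Fin n))} (u : L2 Ω) (g : Fin n → L2 Ω) : Prop :=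
  ∀ (i : Fin n) (φ : 𝓓(Ω, ℝ)),
    ∫ x in Ω, u x * partialDeriv i φ x = -∫ x in Ω, g i x * φ x

/-- `f` is the Laplacian of `u` in `Ω` in the sense of distributions. -/
def HasWeakLaplacian {Ω : Opens (EuclideanSpace ℝ (Fin n))} (u f : L2 Ω) : Prop :=
  ∀ φ : 𝓓(Ω, ℝ), ∫ x in Ω, u x * Laplacian.laplacian (φ : EuclideanSpace ℝ (Fin n) → ℝ) x =
    ∫ x in Ω, f x * φ x

/-- The pairs `(φ, ∇φ)`, `φ ∈ C_c^∞(Ω)`, as elements of `L²(Ω) × L²(Ω)ⁿ`. -/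
def testGraph (Ω : Opens (EuclideanSpace ℝ (Fin n))) : Set (L2 Ω × (Fin n → L2 Ω)) :=
  {p | ∃ φ : 𝓓(Ω, ℝ),
    (p.1 : EuclideanSpace ℝ (Fin n) → ℝ) =ᵐ[volume.restrict (Ω : Set _)] φ ∧
    ∀ i, (p.2 i : EuclideanSpace ℝ (Fin n) → ℝ) =ᵐ[volume.restrict (Ω : Set _)]
      partialDeriv i φ}

/-- `u ∈ H₀¹(Ω)`: `u` lies in `H¹(Ω)` and is a limit of test functions in the norm of `H¹(Ω)`. -/
def MemH10 {Ω : Opens (EuclideanSpace ℝ (Fin n))} (u : L2 Ω) : Prop :=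
  ∃ g : Fin n → L2 Ω, HasWeakGradient u g ∧ (u, g) ∈ closure (testGraph Ω)

/-- An element of `L²(Ω)` that integrates to zero against every test function vanishes. -/
theorem eq_zero_of_integral_test {Ω : Opens (EuclideanSpace ℝ (Fin n))} (u : L2 Ω)
    (h : ∀ φ : 𝓓(Ω, ℝ), ∫ x in Ω, u x * φ x = 0) : u = 0 := by
  have hloc : LocallyIntegrableOn (u : EuclideanSpace ℝ (Fin n) → ℝ) (Ω : Set _) volume := by
    have h1 : LocallyIntegrable (u : EuclideanSpace ℝ (Fin n) → ℝ)
        (volume.restrict (Ω : Set _)) :=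
      (Lp.memLp u).locallyIntegrable (by norm_num)
    exact locallyIntegrableOn_of_locallyIntegrable_restrict h1
  have key := Ω.isOpen.ae_eq_zero_of_integral_contDiff_smul_eq_zero hloc (fun φ h1 h2 h3 => by
    have := h ⟨φ, h1, h2, h3⟩
    rw [← setIntegral_eq_integral_of_forall_compl_eq_zero (s := (Ω : Set _))]
    · simpa [mul_comm] using this
    · intro x hx
      have : φ x = 0 := by
        by_contra hne
        exact hx (h3 (subset_tsupport _ hne))
      simp [this])
  rw [Lp.eq_zero_iff_ae_eq_zero]
  exact (ae_restrict_iff' Ω.isOpen.measurableSet).2 key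

/-- Two elements of `L²(Ω)` with the same integrals against test functions agree. -/
theorem eq_of_integral_test {Ω : Opens (EuclideanSpace ℝ (Fin n))} (u v : L2 Ω)
    (h : ∀ φ : 𝓓(Ω, ℝ), ∫ x in Ω, u x * φ x = ∫ x in Ω, v x * φ x) : u = v := by
  have hint : ∀ (w : L2 Ω) (φ : 𝓓(Ω, ℝ)),
      Integrable (fun x => w x * φ x) (volume.restrict (Ω : Set _)) := fun w φ =>
    (Lp.memLp w).integrable_mul (q := 2)
      ((φ.continuous.memLp_of_hasCompactSupport φ.hasCompactSupport).restrict _)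
  refine sub_eq_zero.1 (eq_zero_of_integral_test _ fun φ => ?_)
  have : ∫ x in Ω, (u - v : L2 Ω) x * φ x = ∫ x in Ω, (u x * φ x - v x * φ x) := by
    refine integral_congr_ae ?_
    filter_upwards [Lp.coeFn_sub u v] with x hx
    rw [hx, Pi.sub_apply, sub_mul]
  rw [this, integral_sub (hint u φ) (hint v φ), h φ, sub_self]

theorem HasWeakGradient.unique {Ω : Opens (EuclideanSpace ℝ (Fin n))} {u : L2 Ω}
    {g g' : Fin n → L2 Ω} (h : HasWeakGradient u g) (h' : HasWeakGradient u g') : g = g' :=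
  funext fun i => eq_of_integral_test _ _ fun φ =>
    neg_injective ((h i φ).symm.trans (h' i φ))

theorem HasWeakLaplacian.unique {Ω : Opens (EuclideanSpace ℝ (Fin n))} {u f f' : L2 Ω}
    (h : HasWeakLaplacian u f) (h' : HasWeakLaplacian u f') : f = f' :=
  eq_of_integral_test _ _ fun φ => (h φ).symm.trans (h' φ)

open Classical in
/-- The weak gradient `∇u ∈ L²(Ω)ⁿ` of `u ∈ H¹(Ω)` (and `0` for other `u`). -/
def weakGradient {Ω : Opens (EuclideanSpace ℝ (Fin n))} (u : L2 Ω) : Fin n → L2 Ω :=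
  if h : ∃ g, HasWeakGradient u g then h.choose else 0

open Classical in
/-- The distributional Laplacian `Δu`, for those `u` with `Δu ∈ L²(Ω)` (and `0` for other `u`). -/
def weakLaplacian {Ω : Opens (EuclideanSpace ℝ (Fin n))} (u : L2 Ω) : L2 Ω :=
  if h : ∃ f, HasWeakLaplacian u f then h.choose else 0

theorem HasWeakGradient.weakGradient_eq {Ω : Opens (EuclideanSpace ℝ (Fin n))} {u : L2 Ω}
    {g : Fin n → L2 Ω} (h : HasWeakGradient u g) : weakGradient u = g := by
  have hex : ∃ g, HasWeakGradient u g := ⟨g, h⟩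
  rw [weakGradient, dif_pos hex]
  exact hex.choose_spec.unique h

theorem HasWeakLaplacian.weakLaplacian_eq {Ω : Opens (EuclideanSpace ℝ (Fin n))} {u f : L2 Ω}
    (h : HasWeakLaplacian u f) : weakLaplacian u = f := by
  have hex : ∃ f, HasWeakLaplacian u f := ⟨f, h⟩
  rw [weakLaplacian, dif_pos hex]
  exact hex.choose_spec.unique h

/-- `‖u‖²_{H¹} = ‖u‖²_{L²} + ‖∇u‖²_{L²}` for `u ∈ H¹(Ω)`. -/
def h1NormSq {Ω : Opens (EuclideanSpace ℝ (Fin n))} (u : L2 Ω) : ℝ :=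
  ‖u‖ ^ 2 + ∑ i, ‖weakGradient u i‖ ^ 2

/-- The domain `{u ∈ H₀¹(Ω) : Δu ∈ L²(Ω)}` of the Dirichlet Laplacian `u ↦ -Δu` on `L²(Ω)`. -/
def dirichletDomain (Ω : Opens (EuclideanSpace ℝ (Fin n))) : Set (L2 Ω) :=
  {u | MemH10 u ∧ ∃ f, HasWeakLaplacian u f}

/-- The orthonormal basis `e` of `L²(Ω)` consists of eigenfunctions of the Dirichlet Laplacian,
`-Δ eᵢ = τᵢ eᵢ`, enumerated so that the eigenvalues are nondecreasing and tend to infinity. -/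
structure IsDirichletEigenbasis {Ω : Opens (EuclideanSpace ℝ (Fin n))}
    (e : HilbertBasis ℕ ℝ (L2 Ω)) (τ : ℕ → ℝ) : Prop where
  mem_domain : ∀ i, e i ∈ dirichletDomain Ω
  eigen : ∀ i, -weakLaplacian (e i) = τ i • e i
  monotone : Monotone τ
  tendsto : Filter.Tendsto τ Filter.atTop Filter.atTop

/-- `N(Λ) = #{i : τᵢ ≤ Λ}`. -/
def modeCount (τ : ℕ → ℝ) (Λ : ℝ) : ℕ := {i | τ i ≤ Λ}.ncard

/-- `P_N y`, the sum of the first `N` terms of the expansion of `y` in the basis `e`. -/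
def lowProj {Ω : Opens (EuclideanSpace ℝ (Fin n))} (e : HilbertBasis ℕ ℝ (L2 Ω)) (N : ℕ)
    (y : L2 Ω) : L2 Ω :=
  ∑ i ∈ Finset.range N, inner ℝ (e i) y • e i

/-- `P_N^⊥ y = y - P_N y`. -/
def highProj {Ω : Opens (EuclideanSpace ℝ (Fin n))} (e : HilbertBasis ℕ ℝ (L2 Ω)) (N : ℕ)
    (y : L2 Ω) : L2 Ω :=
  y - lowProj e N y

/-- Multiplication by the characteristic function `χ_ω` on `L²(Ω)`. -/
def chi {Ω : Opens (EuclideanSpace ℝ (Fin n))} (ω : Opens (EuclideanSpace ℝ (Fin n)))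
    (u : L2 Ω) : L2 Ω :=
  ((Lp.memLp u).indicator ω.isOpen.measurableSet).toLp _

/-- The multivalued sign of a Hilbert space: `f ↦ f / ‖f‖` for `f ≠ 0`, and `0` is sent to the
closed unit ball. -/
def signH {H : Type*} [NormedAddCommGroup H] [InnerProductSpace ℝ H] (f : H) : Set H :=
  {g | (f ≠ 0 → g = ‖f‖⁻¹ • f) ∧ (f = 0 → ‖g‖ ≤ 1)}

/-- The constant `C` is admissible in the spectral inequality
`‖∑_{i < N} aᵢ eᵢ‖²_{L²(ω)} ≥ C ∑_{i < N} aᵢ²`. -/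
def IsSpectralConstant {Ω : Opens (EuclideanSpace ℝ (Fin n))}
    (ω : Opens (EuclideanSpace ℝ (Fin n))) (e : HilbertBasis ℕ ℝ (L2 Ω)) (N : ℕ) (C : ℝ) : Prop :=
  ∀ a : ℕ → ℝ, C * ∑ i ∈ Finset.range N, a i ^ 2 ≤
    ∫ x in ω, ((∑ i ∈ Finset.range N, a i • e i : L2 Ω) x) ^ 2

/-- `(u, v)_μ = μ (P_N u, P_N v) + (P_N^⊥ u, P_N^⊥ v)`. -/
def weightedInner {Ω : Opens (EuclideanSpace ℝ (Fin n))} (e : HilbertBasis ℕ ℝ (L2 Ω)) (N : ℕ)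
    (μ : ℝ) (u v : L2 Ω) : ℝ :=
  μ * inner ℝ (lowProj e N u) (lowProj e N v) + inner ℝ (highProj e N u) (highProj e N v)

/-- `𝒞 y = μ P_N y + P_N^⊥ y`. -/
def weightOp {Ω : Opens (EuclideanSpace ℝ (Fin n))} (e : HilbertBasis ℕ ℝ (L2 Ω)) (N : ℕ)
    (μ : ℝ) (y : L2 Ω) : L2 Ω :=
  μ • lowProj e N y + highProj e N y

/-- The linear part `A₁ y = -Δy + γ χ_ω P_N y` (meaningful for `y` in `dirichletDomain Ω`). -/
def linearPart {Ω : Opens (EuclideanSpace ℝ (Fin n))} (ω : Opens (EuclideanSpace ℝ (Fin n)))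
    (e : HilbertBasis ℕ ℝ (L2 Ω)) (N : ℕ) (γ : ℝ) (y : L2 Ω) : L2 Ω :=
  -weakLaplacian y + γ • chi ω (lowProj e N y)

/-- The multivalued operator `A y = -Δy + γ χ_ω P_N y + χ_ω D sign(χ_ω 𝒞 y)` on `L²(Ω)`, with
domain `dirichletDomain Ω` (it is empty-valued off the domain). -/
def closedLoopOp {Ω : Opens (EuclideanSpace ℝ (Fin n))} (ω : Opens (EuclideanSpace ℝ (Fin n)))
    (e : HilbertBasis ℕ ℝ (L2 Ω)) (N : ℕ) (γ μ D : ℝ) (y : L2 Ω) : Set (L2 Ω) :=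
  {w | y ∈ dirichletDomain Ω ∧ ∃ η ∈ signH (chi ω (weightOp e N μ y)),
    w = linearPart ω e N γ y + chi ω (D • η)}

/-- The values of the operator are nonempty exactly on the domain of the Dirichlet Laplacian. -/
theorem closedLoopOp_nonempty_iff {Ω : Opens (EuclideanSpace ℝ (Fin n))}
    (ω : Opens (EuclideanSpace ℝ (Fin n))) (e : HilbertBasis ℕ ℝ (L2 Ω)) (N : ℕ) (γ μ D : ℝ)
    (y : L2 Ω) : (closedLoopOp ω e N γ μ D y).Nonempty ↔ y ∈ dirichletDomain Ω := by
  refine ⟨fun ⟨w, hw⟩ => hw.1, fun hy => ?_⟩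
  refine ⟨_, hy, ‖chi ω (weightOp e N μ y)‖⁻¹ • chi ω (weightOp e N μ y), ⟨fun _ => rfl, ?_⟩, rfl⟩
  intro h
  simp [h]

/-- A multivalued operator `A` is monotone for the bilinear form `B`. -/
def IsMonotoneFor {H : Type*} [AddCommGroup H] (B : H → H → ℝ) (A : H → Set H) : Prop :=
  ∀ y₁ y₂, ∀ w₁ ∈ A y₁, ∀ w₂ ∈ A y₂, 0 ≤ B (w₁ - w₂) (y₁ - y₂)

end HeatFeedback

end

noncomputable section

namespace HeatFeedback

variable {n : ℕ} {Ω : Opens (EuclideanSpace ℝ (Fin n))}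

/-- The partial derivative of a test function, as a test function. -/
def partialTest (i : Fin n) (φ : 𝓓(Ω, ℝ)) : 𝓓(Ω, ℝ) where
  toFun := partialDeriv i φ
  contDiff' := (φ.contDiff.fderiv_right (by simp)).clm_apply contDiff_const
  hasCompactSupport' := φ.hasCompactSupport.fderiv_apply ℝ _
  tsupport_subset' := (tsupport_fderiv_apply_subset ℝ _).trans φ.tsupport_subset

theorem coe_partialTest (i : Fin n) (φ : 𝓓(Ω, ℝ)) :
    (partialTest i φ : EuclideanSpace ℝ (Fin n) → ℝ) = partialDeriv i φ := rfl

theorem memLp_testFunction (φ : 𝓓(Ω, ℝ)) :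
    MemLp φ 2 (volume.restrict (Ω : Set (EuclideanSpace ℝ (Fin n)))) :=
  (φ.continuous.memLp_of_hasCompactSupport φ.hasCompactSupport).restrict _

/-- A test function as an element of `L²(Ω)`. -/
def testL2 (φ : 𝓓(Ω, ℝ)) : L2 Ω := (memLp_testFunction φ).toLp _

theorem coeFn_testL2 (φ : 𝓓(Ω, ℝ)) :
    (testL2 φ : EuclideanSpace ℝ (Fin n) → ℝ) =ᵐ[volume.restrict (Ω : Set _)] φ :=
  (memLp_testFunction φ).coeFn_toLp

theorem inner_testL2 (u : L2 Ω) (φ : 𝓓(Ω, ℝ)) :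
    inner ℝ u (testL2 φ) = ∫ x in Ω, u x * φ x := by
  rw [MeasureTheory.L2.inner_def]
  refine integral_congr_ae ?_
  filter_upwards [coeFn_testL2 φ] with x hx
  simp [hx, mul_comm]

theorem eq_testL2 {u : L2 Ω} {φ : 𝓓(Ω, ℝ)}
    (h : (u : EuclideanSpace ℝ (Fin n) → ℝ) =ᵐ[volume.restrict (Ω : Set _)] φ) :
    u = testL2 φ :=
  Lp.ext (h.trans (coeFn_testL2 φ).symm)

theorem differentiable_testFunction (φ : 𝓓(Ω, ℝ)) : Differentiable ℝ φ :=
  φ.contDiff.differentiable (by simp)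

theorem testL2_add (φ ψ : 𝓓(Ω, ℝ)) : testL2 (φ + ψ) = testL2 φ + testL2 ψ := by
  refine (eq_testL2 ?_).symm
  filter_upwards [Lp.coeFn_add (testL2 φ) (testL2 ψ), coeFn_testL2 φ, coeFn_testL2 ψ]
    with x h1 h2 h3
  rw [h1, Pi.add_apply, h2, h3, add_apply]

theorem testL2_smul (c : ℝ) (φ : 𝓓(Ω, ℝ)) : testL2 (c • φ) = c • testL2 φ := by
  refine (eq_testL2 ?_).symm
  filter_upwards [Lp.coeFn_smul c (testL2 φ), coeFn_testL2 φ] with x h1 h2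
  simp [h1, h2]

theorem partialTest_add (i : Fin n) (φ ψ : 𝓓(Ω, ℝ)) :
    partialTest i (φ + ψ) = partialTest i φ + partialTest i ψ := by
  ext x
  have : ((φ + ψ : 𝓓(Ω, ℝ)) : EuclideanSpace ℝ (Fin n) → ℝ) = fun x => φ x + ψ x := by
    ext x; simp
  simp only [add_apply, coe_partialTest, partialDeriv, this]
  rw [fderiv_fun_add (differentiable_testFunction φ x) (differentiable_testFunction ψ x)]
  rfl

theorem partialTest_smul (i : Fin n) (c : ℝ) (φ : 𝓓(Ω, ℝ)) :
    partialTest i (c • φ) = c • partialTest i φ := by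
  ext x
  have : ((c • φ : 𝓓(Ω, ℝ)) : EuclideanSpace ℝ (Fin n) → ℝ) = fun x => c • φ x := by
    ext x; simp
  simp only [smul_apply, coe_partialTest, partialDeriv, this]
  rw [fderiv_fun_const_smul (differentiable_testFunction φ x)]
  rfl

theorem laplacian_eq_sum_partialTest (φ : 𝓓(Ω, ℝ)) (x : EuclideanSpace ℝ (Fin n)) :
    Laplacian.laplacian (φ : EuclideanSpace ℝ (Fin n) → ℝ) x =
      (∑ i, partialTest i (partialTest i φ)) x := by
  rw [InnerProductSpace.laplacian_eq_iteratedFDeriv_orthonormalBasis _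
    (EuclideanSpace.basisFun (Fin n) ℝ)]
  refine Eq.trans ?_ (map_sum (AddMonoidHom.mk' (fun ψ : 𝓓(Ω, ℝ) => ψ x)
    fun ψ₁ ψ₂ => add_apply ψ₁ ψ₂ x) _ _).symm
  simp only [AddMonoidHom.mk'_apply]
  refine Finset.sum_congr rfl fun i _ => ?_
  have hd : DifferentiableAt ℝ (fderiv ℝ φ) x :=
    ((φ.contDiff.fderiv_right (m := (⊤ : ℕ∞)) (by simp)).differentiable (by simp)) x
  rw [iteratedFDeriv_two_apply, coe_partialTest, partialDeriv, coe_partialTest]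
  unfold partialDeriv
  rw [fderiv_clm_apply hd (differentiableAt_const _)]
  simp

/-- The additive embedding of test functions into `L²(Ω)`. -/
def testL2Hom : 𝓓(Ω, ℝ) →+ L2 Ω := AddMonoidHom.mk' testL2 testL2_add

theorem hasWeakGradient_iff {u : L2 Ω} {g : Fin n → L2 Ω} :
    HasWeakGradient u g ↔ ∀ i φ,
      inner ℝ u (testL2 (partialTest i φ)) = -inner ℝ (g i) (testL2 φ) := by
  simp only [HasWeakGradient, inner_testL2, coe_partialTest]

theorem hasWeakLaplacian_iff {u f : L2 Ω} :
    HasWeakLaplacian u f ↔ ∀ φ,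
      ∑ i, inner ℝ u (testL2 (partialTest i (partialTest i φ))) = inner ℝ f (testL2 φ) := by
  have key : ∀ φ : 𝓓(Ω, ℝ), ∑ i, inner ℝ u (testL2 (partialTest i (partialTest i φ))) =
      ∫ x in Ω, u x * Laplacian.laplacian (φ : EuclideanSpace ℝ (Fin n) → ℝ) x := fun φ => by
    simp only [laplacian_eq_sum_partialTest]
    rw [← inner_testL2, ← inner_sum]
    exact congrArg _ (map_sum testL2Hom _ _).symm
  simp only [HasWeakLaplacian, key]
  simp only [inner_testL2]

/-- The pairs `(φ, ∇φ)` with `φ` a test function form a subspace. -/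
def testSubmodule (Ω : Opens (EuclideanSpace ℝ (Fin n))) :
    Submodule ℝ (L2 Ω × (Fin n → L2 Ω)) where
  carrier := {p | ∃ φ : 𝓓(Ω, ℝ), p = (testL2 φ, fun i => testL2 (partialTest i φ))}
  zero_mem' := ⟨0, by
    have h0 : testL2 (0 : 𝓓(Ω, ℝ)) = 0 := map_zero (testL2Hom (Ω := Ω))
    have h1 (i : Fin n) : partialTest i (0 : 𝓓(Ω, ℝ)) = 0 := by
      simpa using partialTest_smul i 0 (0 : 𝓓(Ω, ℝ))
    ext1
    · exact h0.symm
    · funext i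
      simp [h1, h0]⟩
  add_mem' := by
    rintro _ _ ⟨φ, rfl⟩ ⟨ψ, rfl⟩
    exact ⟨φ + ψ, by simp only [partialTest_add, testL2_add]; rfl⟩
  smul_mem' := by
    rintro c _ ⟨φ, rfl⟩
    exact ⟨c • φ, by simp only [partialTest_smul, testL2_smul]; rfl⟩

theorem testGraph_eq : testGraph Ω = testSubmodule Ω := by
  ext ⟨u, g⟩
  refine ⟨fun ⟨φ, hu, hg⟩ => ⟨φ, ?_⟩, fun ⟨φ, h⟩ => ⟨φ, ?_⟩⟩
  · exact Prod.ext (eq_testL2 hu) (funext fun i => eq_testL2 (φ := partialTest i φ) (hg i))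
  · obtain ⟨rfl, rfl⟩ := Prod.mk.inj h
    exact ⟨coeFn_testL2 φ, fun i => coeFn_testL2 (partialTest i φ)⟩

/-- The triples `(u, ∇u, Δu)` for `u` in the domain of the Dirichlet Laplacian. -/
def dirichletGraph (Ω : Opens (EuclideanSpace ℝ (Fin n))) :
    Submodule ℝ (L2 Ω × (Fin n → L2 Ω) × L2 Ω) where
  carrier := {p | HasWeakGradient p.1 p.2.1 ∧
    (p.1, p.2.1) ∈ (testSubmodule Ω).topologicalClosure ∧ HasWeakLaplacian p.1 p.2.2}
  zero_mem' := by
    refine ⟨?_, zero_mem _, ?_⟩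
    · simp [hasWeakGradient_iff]
    · simp [hasWeakLaplacian_iff]
  add_mem' := by
    rintro p q ⟨h1, h2, h3⟩ ⟨k1, k2, k3⟩
    rw [hasWeakGradient_iff] at h1 k1
    rw [hasWeakLaplacian_iff] at h3 k3
    refine ⟨hasWeakGradient_iff.2 fun i φ => ?_, add_mem h2 k2,
      hasWeakLaplacian_iff.2 fun φ => ?_⟩
    · simp only [Prod.fst_add, Prod.snd_add, Pi.add_apply, inner_add_left, h1, k1]
      ring
    · simp only [Prod.fst_add, Prod.snd_add, inner_add_left, Finset.sum_add_distrib, h3, k3]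
  smul_mem' := by
    rintro c p ⟨h1, h2, h3⟩
    rw [hasWeakGradient_iff] at h1
    rw [hasWeakLaplacian_iff] at h3
    refine ⟨hasWeakGradient_iff.2 fun i φ => ?_, Submodule.smul_mem _ c h2,
      hasWeakLaplacian_iff.2 fun φ => ?_⟩
    · simp only [Prod.smul_fst, Prod.smul_snd, Pi.smul_apply, real_inner_smul_left, h1]
      ring
    · simp only [Prod.smul_fst, Prod.smul_snd, real_inner_smul_left, ← Finset.mul_sum, h3]

theorem weakLaplacian_eq_of_mem {p : L2 Ω × (Fin n → L2 Ω) × L2 Ω} (hp : p ∈ dirichletGraph Ω) :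
    weakLaplacian p.1 = p.2.2 :=
  hp.2.2.weakLaplacian_eq

theorem mem_dirichletGraph_of_mem_domain {u : L2 Ω} (hu : u ∈ dirichletDomain Ω) :
    (u, weakGradient u, weakLaplacian u) ∈ dirichletGraph Ω := by
  obtain ⟨⟨g, hg, hc⟩, f, hf⟩ := hu
  rw [hg.weakGradient_eq, hf.weakLaplacian_eq]
  rw [testGraph_eq] at hc
  exact ⟨hg, hc, hf⟩

theorem mem_domain_of_mem_dirichletGraph {p : L2 Ω × (Fin n → L2 Ω) × L2 Ω}
    (hp : p ∈ dirichletGraph Ω) : p.1 ∈ dirichletDomain Ω :=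
  ⟨⟨p.2.1, hp.1, by rw [testGraph_eq]; exact hp.2.1⟩, p.2.2, hp.2.2⟩

/-- Green's formula `(-Δu, v) = (∇u, ∇v)` in the domain of the Dirichlet Laplacian. -/
theorem neg_inner_laplacian_eq {p q : L2 Ω × (Fin n → L2 Ω) × L2 Ω}
    (hp : p ∈ dirichletGraph Ω) (hq : q ∈ dirichletGraph Ω) :
    -inner ℝ p.2.2 q.1 = ∑ i, inner ℝ (p.2.1 i) (q.2.1 i) := by
  have hclosed : IsClosed {r : L2 Ω × (Fin n → L2 Ω) |
      -inner ℝ p.2.2 r.1 = ∑ i, inner ℝ (p.2.1 i) (r.2 i)} :=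
    isClosed_eq (by fun_prop) (by fun_prop)
  refine closure_minimal (s := (testSubmodule Ω : Set _)) ?_ hclosed hq.2.1
  rintro _ ⟨φ, rfl⟩
  have h1 := hasWeakGradient_iff.1 hp.1
  have h3 := hasWeakLaplacian_iff.1 hp.2.2 φ
  simp only [h1, Finset.sum_neg_distrib] at h3
  simp only [mem_ofPred_eq, ← h3, neg_neg]

theorem lowProj_sub (e : HilbertBasis ℕ ℝ (L2 Ω)) (N : ℕ) (u v : L2 Ω) :
    lowProj e N (u - v) = lowProj e N u - lowProj e N v := by
  simp [lowProj, inner_sub_right, sub_smul]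

theorem lowProj_add_highProj (e : HilbertBasis ℕ ℝ (L2 Ω)) (N : ℕ) (u : L2 Ω) :
    lowProj e N u + highProj e N u = u := by
  simp [highProj]

theorem inner_basis_lowProj (e : HilbertBasis ℕ ℝ (L2 Ω)) (N : ℕ) (u : L2 Ω) (j : ℕ) :
    inner ℝ (e j) (lowProj e N u) = if j < N then inner ℝ (e j) u else 0 := by
  simp [lowProj, inner_sum, real_inner_smul_right, orthonormal_iff_ite.1 e.orthonormal]

theorem inner_basis_highProj (e : HilbertBasis ℕ ℝ (L2 Ω)) (N : ℕ) (u : L2 Ω) (j : ℕ) :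
    inner ℝ (e j) (highProj e N u) = if j < N then 0 else inner ℝ (e j) u := by
  rw [highProj, inner_sub_right, inner_basis_lowProj]
  split_ifs <;> simp

theorem inner_lowProj_highProj (e : HilbertBasis ℕ ℝ (L2 Ω)) (N : ℕ) (u v : L2 Ω) :
    inner ℝ (lowProj e N u) (highProj e N v) = 0 := by
  rw [lowProj, sum_inner]
  refine Finset.sum_eq_zero fun i hi => ?_
  rw [real_inner_smul_left, inner_basis_highProj, if_pos (Finset.mem_range.1 hi), mul_zero]

theorem weightOp_sub (e : HilbertBasis ℕ ℝ (L2 Ω)) (N : ℕ) (μ : ℝ) (u v : L2 Ω) :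
    weightOp e N μ (u - v) = weightOp e N μ u - weightOp e N μ v := by
  simp only [weightOp, highProj, lowProj_sub, smul_sub]
  abel

/-- `(u, v)_μ = (u, 𝒞 v)`. -/
theorem weightedInner_eq (e : HilbertBasis ℕ ℝ (L2 Ω)) (N : ℕ) (μ : ℝ) (u v : L2 Ω) :
    weightedInner e N μ u v = inner ℝ u (weightOp e N μ v) := by
  conv_rhs => rw [← lowProj_add_highProj e N u]
  simp only [weightOp, inner_add_left, inner_add_right, real_inner_smul_right,
    inner_lowProj_highProj, real_inner_comm (lowProj e N v) (highProj e N u), weightedInner]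
  ring

variable (ω : Opens (EuclideanSpace ℝ (Fin n)))

theorem coeFn_chi (u : L2 Ω) :
    (chi ω u : EuclideanSpace ℝ (Fin n) → ℝ) =ᵐ[volume.restrict (Ω : Set _)]
      (ω : Set (EuclideanSpace ℝ (Fin n))).indicator u :=
  MemLp.coeFn_toLp _

theorem chi_sub (u v : L2 Ω) : chi ω (u - v) = chi ω u - chi ω v := by
  refine Lp.ext ?_
  filter_upwards [coeFn_chi ω (u - v), coeFn_chi ω u, coeFn_chi ω v,
    Lp.coeFn_sub (chi ω u) (chi ω v), Lp.coeFn_sub u v] with x h1 h2 h3 h4 h5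
  rw [h1, h4, Pi.sub_apply, h2, h3]
  by_cases hx : x ∈ (ω : Set (EuclideanSpace ℝ (Fin n)))
  · simp only [indicator_of_mem hx, h5, Pi.sub_apply]
  · simp [indicator_of_notMem hx]

theorem chi_smul (c : ℝ) (u : L2 Ω) : chi ω (c • u) = c • chi ω u := by
  refine Lp.ext ?_
  filter_upwards [coeFn_chi ω (c • u), coeFn_chi ω u, Lp.coeFn_smul c (chi ω u),
    Lp.coeFn_smul c u] with x h1 h2 h3 h4
  rw [h1, h3, Pi.smul_apply, h2]
  by_cases hx : x ∈ (ω : Set (EuclideanSpace ℝ (Fin n)))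
  · simp only [indicator_of_mem hx, h4, Pi.smul_apply]
  · simp [indicator_of_notMem hx]

theorem inner_chi (u v : L2 Ω) : inner ℝ (chi ω u) v = inner ℝ u (chi ω v) := by
  rw [MeasureTheory.L2.inner_def, MeasureTheory.L2.inner_def]
  refine integral_congr_ae ?_
  filter_upwards [coeFn_chi ω u, coeFn_chi ω v] with x h1 h2
  rw [h1, h2]
  by_cases hx : x ∈ (ω : Set (EuclideanSpace ℝ (Fin n)))
  · simp only [indicator_of_mem hx]
  · simp [indicator_of_notMem hx]

theorem inner_chi_eq (u v : L2 Ω) : inner ℝ (chi ω u) v = inner ℝ (chi ω u) (chi ω v) := by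
  have h : chi ω (chi ω u) = chi ω u := by
    refine Lp.ext ?_
    filter_upwards [coeFn_chi ω (chi ω u), coeFn_chi ω u] with x h1 h2
    rw [h1]
    by_cases hx : x ∈ (ω : Set (EuclideanSpace ℝ (Fin n)))
    · simp only [indicator_of_mem hx]
    · simp only [indicator_of_notMem hx, h2]
  rw [← inner_chi, h]

theorem norm_chi_le (u : L2 Ω) : ‖chi ω u‖ ≤ ‖u‖ := by
  refine Lp.norm_le_norm_of_ae_le ?_
  filter_upwards [coeFn_chi ω u] with x h
  rw [h]
  exact norm_indicator_le_norm_self _ _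

variable {ω} in
theorem norm_chi_sq (hωΩ : ω ≤ Ω) (u : L2 Ω) : ‖chi ω u‖ ^ 2 = ∫ x in ω, (u x) ^ 2 := by
  rw [← real_inner_self_eq_norm_sq, MeasureTheory.L2.inner_def]
  have h : ∫ x in Ω, inner ℝ (chi ω u x) (chi ω u x) =
      ∫ x in Ω, (ω : Set (EuclideanSpace ℝ (Fin n))).indicator (fun x => (u x) ^ 2) x := by
    refine integral_congr_ae ?_
    filter_upwards [coeFn_chi ω u] with x h
    rw [h]
    by_cases hx : x ∈ (ω : Set (EuclideanSpace ℝ (Fin n)))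
    · simp [indicator_of_mem hx]
    · simp [indicator_of_notMem hx]
  rw [h, integral_indicator ω.isOpen.measurableSet,
    Measure.restrict_restrict_of_subset hωΩ]

theorem norm_lowProj_sq (e : HilbertBasis ℕ ℝ (L2 Ω)) (N : ℕ) (u : L2 Ω) :
    ‖lowProj e N u‖ ^ 2 = ∑ i ∈ Finset.range N, (inner ℝ (e i) u) ^ 2 := by
  rw [← real_inner_self_eq_norm_sq]
  conv_lhs => enter [2]; rw [lowProj]
  rw [sum_inner]
  refine Finset.sum_congr rfl fun i hi => ?_
  rw [real_inner_smul_left, inner_basis_lowProj, if_pos (Finset.mem_range.1 hi), sq]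

variable {ω} in
theorem IsSpectralConstant.le_norm_chi_lowProj (hωΩ : ω ≤ Ω) {e : HilbertBasis ℕ ℝ (L2 Ω)}
    {N : ℕ} {C : ℝ} (h : IsSpectralConstant ω e N C) (u : L2 Ω) :
    C * ‖lowProj e N u‖ ^ 2 ≤ ‖chi ω (lowProj e N u)‖ ^ 2 := by
  rw [norm_chi_sq hωΩ, norm_lowProj_sq]
  exact h fun i => inner ℝ (e i) u

theorem norm_le_one_of_mem_signH {H : Type*} [NormedAddCommGroup H] [InnerProductSpace ℝ H]
    {f g : H} (h : g ∈ signH f) : ‖g‖ ≤ 1 := by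
  by_cases hf : f = 0
  · exact h.2 hf
  · rw [h.1 hf, norm_smul, norm_inv, norm_norm, inv_mul_cancel₀ (norm_ne_zero_iff.2 hf)]

theorem inner_eq_norm_of_mem_signH {H : Type*} [NormedAddCommGroup H] [InnerProductSpace ℝ H]
    {f g : H} (h : g ∈ signH f) : inner ℝ g f = ‖f‖ := by
  by_cases hf : f = 0
  · simp [hf]
  · rw [h.1 hf, real_inner_smul_left, real_inner_self_eq_norm_sq, sq,
      inv_mul_cancel_left₀ (norm_ne_zero_iff.2 hf)]

/-- The sign of a Hilbert space, a subdifferential of the norm, is monotone. -/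
theorem inner_sub_nonneg_of_mem_signH {H : Type*} [NormedAddCommGroup H] [InnerProductSpace ℝ H]
    {f₁ f₂ g₁ g₂ : H} (h₁ : g₁ ∈ signH f₁) (h₂ : g₂ ∈ signH f₂) :
    0 ≤ inner ℝ (g₁ - g₂) (f₁ - f₂) := by
  have key : ∀ {f g k : H}, g ∈ signH k → inner ℝ g f ≤ ‖f‖ := fun {f g k} h =>
    (real_inner_le_norm g f).trans
      (mul_le_of_le_one_left (norm_nonneg _) (norm_le_one_of_mem_signH h))
  have h12 := key (f := f₂) h₁
  have h21 := key (f := f₁) h₂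
  simp only [inner_sub_left, inner_sub_right, inner_eq_norm_of_mem_signH h₁,
    inner_eq_norm_of_mem_signH h₂]
  linarith

theorem lt_of_modeCount_le {τ : ℕ → ℝ} (hm : Monotone τ)
    (ht : Filter.Tendsto τ Filter.atTop Filter.atTop) {Λ : ℝ} {i : ℕ} (hi : modeCount τ Λ ≤ i) :
    Λ < τ i := by
  by_contra! hle
  have hfin : {j | τ j ≤ Λ}.Finite := by
    obtain ⟨M, hM⟩ := Filter.eventually_atTop.1 (ht.eventually_gt_atTop Λ)
    refine (Set.finite_lt_nat M).subset fun j hj => ?_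
    by_contra hjM
    exact absurd (hM j (not_lt.1 hjM)) (not_lt.2 hj)
  have hsub : (Finset.range (i + 1) : Set ℕ) ⊆ {j | τ j ≤ Λ} := fun j hj =>
    (hm (Nat.lt_succ_iff.1 (Finset.mem_range.1 hj))).trans hle
  have := Set.ncard_le_ncard hsub hfin
  rw [Set.ncard_coe_finset, Finset.card_range] at this
  exact absurd hi (by unfold modeCount; omega)

namespace IsDirichletEigenbasis

variable {e : HilbertBasis ℕ ℝ (L2 Ω)} {τ : ℕ → ℝ}

theorem mem_graph (he : IsDirichletEigenbasis e τ) (i : ℕ) :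
    (e i, weakGradient (e i), -(τ i • e i)) ∈ dirichletGraph Ω := by
  have := mem_dirichletGraph_of_mem_domain (he.mem_domain i)
  rwa [← he.eigen i, neg_neg]

/-- The expansion coefficients of `-Δu` are `τᵢ (eᵢ, u)`. -/
theorem inner_laplacian (he : IsDirichletEigenbasis e τ)
    {p : L2 Ω × (Fin n → L2 Ω) × L2 Ω} (hp : p ∈ dirichletGraph Ω) (i : ℕ) :
    -inner ℝ p.2.2 (e i) = τ i * inner ℝ (e i) p.1 := by
  have h1 := neg_inner_laplacian_eq hp (he.mem_graph i)
  have h2 := neg_inner_laplacian_eq (he.mem_graph i) hp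
  simp only at h1 h2
  rw [h1]
  simp only [real_inner_comm] at h2 ⊢
  rw [← h2]
  simp [real_inner_smul_right]

theorem lowProj_mem_graph (he : IsDirichletEigenbasis e τ) (N : ℕ) (u : L2 Ω) :
    ∃ g : Fin n → L2 Ω,
      (lowProj e N u, g, -∑ i ∈ Finset.range N, (inner ℝ (e i) u * τ i) • e i) ∈
        dirichletGraph Ω := by
  have := Submodule.sum_mem (dirichletGraph Ω) (t := Finset.range N)
    fun i _ => Submodule.smul_mem _ (inner ℝ (e i) u) (he.mem_graph i)
  refine ⟨(∑ i ∈ Finset.range N, inner ℝ (e i) u •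
    ((e i, weakGradient (e i), -(τ i • e i)) : L2 Ω × (Fin n → L2 Ω) × L2 Ω)).2.1, ?_⟩
  convert this using 1
  ext1
  · simp [lowProj, Prod.fst_sum]
  · ext1
    · rfl
    · simp [Prod.snd_sum, mul_smul]

/-- The Poincaré inequality on the high modes. -/
theorem mul_norm_sq_le (he : IsDirichletEigenbasis e τ) {Λ : ℝ} {N : ℕ} (hN : ∀ i, N ≤ i → Λ ≤ τ i)
    {p : L2 Ω × (Fin n → L2 Ω) × L2 Ω} (hp : p ∈ dirichletGraph Ω)
    (hlow : ∀ i, i < N → inner ℝ (e i) p.1 = 0) :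
    Λ * ‖p.1‖ ^ 2 ≤ ∑ i, ‖p.2.1 i‖ ^ 2 := by
  have hG := neg_inner_laplacian_eq hp hp
  simp only [real_inner_self_eq_norm_sq] at hG
  rw [← hG, ← real_inner_self_eq_norm_sq]
  have s1 := (e.hasSum_inner_mul_inner p.1 p.1).mul_left Λ
  have s2 := (e.hasSum_inner_mul_inner p.2.2 p.1).neg
  refine hasSum_le (fun i => ?_) s1 s2
  rw [← neg_mul, he.inner_laplacian hp i, real_inner_comm (e i) p.1, mul_assoc]
  rcases lt_or_ge i N with hi | hi
  · simp [hlow i hi]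
  · exact mul_le_mul_of_nonneg_right (hN i hi) (mul_self_nonneg _)

end IsDirichletEigenbasis

/-- The real inequality behind the coercivity: `P = ‖P_N y‖`, `Q = ‖P_N^⊥ y‖`, `a = ‖χ_ω P_N y‖`,
`S = (χ_ω P_N y, P_N^⊥ y)`, and `G`, `K` are the Dirichlet energies of the two parts. -/
theorem coercivity_estimate {Λ C P Q a S G K c : ℝ} (hΛ : 0 < Λ) (hC : 0 < C)
    (hQ : 0 ≤ Q) (hG : 0 ≤ G) (hG0 : P = 0 → G = 0) (hP : 0 ≤ P)
    (ha : C * P ^ 2 ≤ a ^ 2) (ha0 : 0 ≤ a) (haP : a ≤ P) (hS : -(a * Q) ≤ S) (hK : Λ * Q ^ 2 ≤ K)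
    (h1 : c ≤ 1 / 2) (h2 : c ≤ Λ / C ^ 2 * (1 - Real.sqrt 2 / 2))
    (h3 : c ≤ Λ / 2 * (1 - Real.sqrt 2 / 2)) :
    c * (P ^ 2 + Q ^ 2 + (G + K)) ≤
      1 / C ^ 2 * G + K + Λ / C * (1 / C ^ 2 * a ^ 2 + S) := by
  have hGμ : c * G ≤ 1 / C ^ 2 * G := by
    rcases hP.eq_or_lt with h0 | h0
    · simp [hG0 h0.symm]
    · have hC1 : C ≤ 1 := by
        have : C * P ^ 2 ≤ 1 * P ^ 2 := by rw [one_mul]; exact ha.trans (by gcongr)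
        exact le_of_mul_le_mul_right this (by positivity)
      have : 1 ≤ 1 / C ^ 2 := by
        rw [le_div_iff₀ (by positivity), one_mul]
        exact pow_le_one₀ hC.le hC1
      exact mul_le_mul_of_nonneg_right (by linarith) hG
  have hK0 : 0 ≤ K := le_trans (by positivity) hK
  have hKc : c * K ≤ 1 / 2 * K := mul_le_mul_of_nonneg_right h1 hK0
  have hPc : c * P ^ 2 ≤ Λ / C ^ 2 * (1 - Real.sqrt 2 / 2) * P ^ 2 :=
    mul_le_mul_of_nonneg_right h2 (sq_nonneg _)
  have hQc : c * Q ^ 2 ≤ Λ / 2 * (1 - Real.sqrt 2 / 2) * Q ^ 2 :=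
    mul_le_mul_of_nonneg_right h3 (sq_nonneg _)
  have hS' : -(P * Q) ≤ S := le_trans (neg_le_neg (mul_le_mul_of_nonneg_right haP hQ)) hS
  have hmain : Λ * ((P / C) ^ 2 - (P / C) * Q) ≤ Λ / C * (1 / C ^ 2 * a ^ 2 + S) := by
    have : Λ / C * (1 / C ^ 2 * (C * P ^ 2) + -(P * Q)) ≤ Λ / C * (1 / C ^ 2 * a ^ 2 + S) := by
      gcongr
    refine le_trans (le_of_eq ?_) this
    field_simp
    ring
  have hs : Real.sqrt 2 ^ 2 = 2 := Real.sq_sqrt (by norm_num)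
  have hyoung : Λ * ((P / C) * Q) ≤
      Λ * (Real.sqrt 2 / 2 * (P / C) ^ 2 + Real.sqrt 2 / 4 * Q ^ 2) := by
    refine mul_le_mul_of_nonneg_left ?_ hΛ.le
    have : 0 ≤ Real.sqrt 2 / 4 * (Real.sqrt 2 * (P / C) - Q) ^ 2 := by positivity
    have hid : Real.sqrt 2 / 4 * (Real.sqrt 2 * (P / C) - Q) ^ 2 =
        Real.sqrt 2 ^ 2 * Real.sqrt 2 / 4 * (P / C) ^ 2 - Real.sqrt 2 ^ 2 / 2 * ((P / C) * Q)
          + Real.sqrt 2 / 4 * Q ^ 2 := by ring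
    rw [hid, hs] at this
    linarith
  have hrw : Λ / C ^ 2 * (1 - Real.sqrt 2 / 2) * P ^ 2 =
      Λ * (1 - Real.sqrt 2 / 2) * (P / C) ^ 2 := by
    rw [div_pow]; ring
  rw [hrw] at hPc
  linarith

theorem weightedInner_linearPart (e : HilbertBasis ℕ ℝ (L2 Ω)) (N : ℕ) (γ μ : ℝ) (y : L2 Ω) :
    weightedInner e N μ (linearPart ω e N γ y) y =
      μ * -inner ℝ (weakLaplacian y) (lowProj e N y) +
        -inner ℝ (weakLaplacian y) (highProj e N y) +
        γ * (μ * ‖chi ω (lowProj e N y)‖ ^ 2 +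
          inner ℝ (chi ω (lowProj e N y)) (highProj e N y)) := by
  rw [weightedInner_eq, linearPart, weightOp,
    ← real_inner_self_eq_norm_sq (chi ω (lowProj e N y)), ← inner_chi_eq]
  simp only [inner_add_left, inner_add_right, inner_neg_left, real_inner_smul_left,
    real_inner_smul_right]
  ring

theorem norm_add_sq_of_inner_eq_zero {H : Type*} [NormedAddCommGroup H] [InnerProductSpace ℝ H]
    {x y : H} (h : inner ℝ x y = 0) : ‖x + y‖ ^ 2 = ‖x‖ ^ 2 + ‖y‖ ^ 2 := by
  rw [norm_add_sq_real, h]; ring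

theorem sum_inner_gradient_comm (g h : Fin n → L2 Ω) :
    ∑ i, inner ℝ (g i) (h i) = ∑ i, inner ℝ (h i) (g i) :=
  Finset.sum_congr rfl fun _ _ => real_inner_comm _ _

theorem neg_inner_laplacian_self {p : L2 Ω × (Fin n → L2 Ω) × L2 Ω} (hp : p ∈ dirichletGraph Ω) :
    -inner ℝ p.2.2 p.1 = ∑ i, ‖p.2.1 i‖ ^ 2 := by
  simpa only [real_inner_self_eq_norm_sq] using neg_inner_laplacian_eq hp hp

/-- The Dirichlet energy of a sum whose terms are orthogonal for the Dirichlet form. -/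
theorem energy_add {p q : L2 Ω × (Fin n → L2 Ω) × L2 Ω} (hp : p ∈ dirichletGraph Ω)
    (hq : q ∈ dirichletGraph Ω) (h : inner ℝ p.2.2 q.1 = 0) :
    -inner ℝ (p.2.2 + q.2.2) p.1 = ∑ i, ‖p.2.1 i‖ ^ 2 ∧
    -inner ℝ (p.2.2 + q.2.2) q.1 = ∑ i, ‖q.2.1 i‖ ^ 2 ∧
    ∑ i, ‖p.2.1 i + q.2.1 i‖ ^ 2 = ∑ i, ‖p.2.1 i‖ ^ 2 + ∑ i, ‖q.2.1 i‖ ^ 2 := by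
  have hcross : ∑ i, inner ℝ (p.2.1 i) (q.2.1 i) = 0 := by
    rw [← neg_inner_laplacian_eq hp hq, h, neg_zero]
  have h' : inner ℝ q.2.2 p.1 = 0 := by
    rw [← neg_eq_zero, neg_inner_laplacian_eq hq hp, sum_inner_gradient_comm, hcross]
  refine ⟨?_, ?_, ?_⟩
  · rw [inner_add_left, h', add_zero, neg_inner_laplacian_self hp]
  · rw [inner_add_left, h, zero_add, neg_inner_laplacian_self hq]
  · simp only [norm_add_sq_real, Finset.sum_add_distrib, ← Finset.mul_sum, hcross]
    ring

/-- The Dirichlet energy splits orthogonally along the low and the high modes. -/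
theorem IsDirichletEigenbasis.exists_energy_split {e : HilbertBasis ℕ ℝ (L2 Ω)} {τ : ℕ → ℝ}
    (he : IsDirichletEigenbasis e τ) {Λ : ℝ} {N : ℕ} (hN : ∀ i, N ≤ i → Λ ≤ τ i) {y : L2 Ω}
    (hy : y ∈ dirichletDomain Ω) :
    ∃ G K : ℝ, 0 ≤ G ∧ (‖lowProj e N y‖ = 0 → G = 0) ∧ Λ * ‖highProj e N y‖ ^ 2 ≤ K ∧
      -inner ℝ (weakLaplacian y) (lowProj e N y) = G ∧
      -inner ℝ (weakLaplacian y) (highProj e N y) = K ∧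
      ∑ i, ‖weakGradient y i‖ ^ 2 = G + K := by
  obtain ⟨g, hp⟩ := he.lowProj_mem_graph N y
  have hq := Submodule.sub_mem _ (mem_dirichletGraph_of_mem_domain hy) hp
  have horth : inner ℝ (-∑ i ∈ Finset.range N, (inner ℝ (e i) y * τ i) • e i)
      (highProj e N y) = 0 := by
    rw [inner_neg_left, sum_inner, neg_eq_zero]
    refine Finset.sum_eq_zero fun i hi => ?_
    rw [real_inner_smul_left, inner_basis_highProj, if_pos (Finset.mem_range.1 hi), mul_zero]
  generalize -∑ i ∈ Finset.range N, (inner ℝ (e i) y * τ i) • e i = f at hp hq horth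
  have hq' : (highProj e N y, weakGradient y - g, weakLaplacian y - f) ∈ dirichletGraph Ω := hq
  obtain ⟨h1, h2, h3⟩ := energy_add hp hq' horth
  simp only [add_sub_cancel, Pi.sub_apply] at h1 h2 h3
  refine ⟨_, _, Finset.sum_nonneg fun _ _ => sq_nonneg _, fun h0 => ?_, ?_, h1, h2, h3⟩
  · rw [← h1, norm_eq_zero.1 h0, inner_zero_right, neg_zero]
  · have hlow : ∀ i, i < N → inner ℝ (e i) (highProj e N y) = 0 := fun i hi => by
      rw [inner_basis_highProj, if_pos hi]
    have h := he.mul_norm_sq_le hN hq' hlow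
    exact h

variable {ω} in
theorem coercive_linearPart (hωΩ : ω ≤ Ω) {e : HilbertBasis ℕ ℝ (L2 Ω)} {τ : ℕ → ℝ}
    (he : IsDirichletEigenbasis e τ) {Λ : ℝ} (hΛ : 0 < Λ) {C : ℝ} (hC : 0 < C) {N : ℕ}
    (hN : ∀ i, N ≤ i → Λ ≤ τ i) (hspec : IsSpectralConstant ω e N C) {c : ℝ}
    (h1 : c ≤ 1 / 2) (h2 : c ≤ Λ / C ^ 2 * (1 - Real.sqrt 2 / 2))
    (h3 : c ≤ Λ / 2 * (1 - Real.sqrt 2 / 2)) {y : L2 Ω} (hy : y ∈ dirichletDomain Ω) :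
    c * h1NormSq y ≤ weightedInner e N (1 / C ^ 2) (linearPart ω e N (Λ / C) y) y := by
  obtain ⟨G, K, hG, hG0, hK, hyp, hyq, hgrad⟩ := he.exists_energy_split hN hy
  have hnorm : ‖y‖ ^ 2 = ‖lowProj e N y‖ ^ 2 + ‖highProj e N y‖ ^ 2 := by
    rw [← norm_add_sq_of_inner_eq_zero (inner_lowProj_highProj e N y y), lowProj_add_highProj]
  have hS : -(‖chi ω (lowProj e N y)‖ * ‖highProj e N y‖) ≤
      inner ℝ (chi ω (lowProj e N y)) (highProj e N y) :=
    (abs_le.1 (abs_real_inner_le_norm _ _)).1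
  rw [weightedInner_linearPart, hyp, hyq, h1NormSq, hnorm, hgrad]
  exact coercivity_estimate hΛ hC (norm_nonneg _) hG hG0 (norm_nonneg _)
    (hspec.le_norm_chi_lowProj hωΩ y) (norm_nonneg _) (norm_chi_le ω _) hS hK h1 h2 h3

theorem sub_mem_dirichletDomain {u v : L2 Ω} (hu : u ∈ dirichletDomain Ω)
    (hv : v ∈ dirichletDomain Ω) : u - v ∈ dirichletDomain Ω :=
  mem_domain_of_mem_dirichletGraph (Submodule.sub_mem _ (mem_dirichletGraph_of_mem_domain hu)
    (mem_dirichletGraph_of_mem_domain hv))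

theorem linearPart_sub (e : HilbertBasis ℕ ℝ (L2 Ω)) (N : ℕ) (γ : ℝ) {u v : L2 Ω}
    (hu : u ∈ dirichletDomain Ω) (hv : v ∈ dirichletDomain Ω) :
    linearPart ω e N γ (u - v) = linearPart ω e N γ u - linearPart ω e N γ v := by
  have h : weakLaplacian (u - v) = weakLaplacian u - weakLaplacian v :=
    weakLaplacian_eq_of_mem (Submodule.sub_mem _ (mem_dirichletGraph_of_mem_domain hu)
      (mem_dirichletGraph_of_mem_domain hv))
  simp only [linearPart, h, lowProj_sub, chi_sub, smul_sub]
  abel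

/-- Adding the sign feedback to a monotone linear part keeps monotonicity. -/
theorem isMonotoneFor_closedLoopOp (e : HilbertBasis ℕ ℝ (L2 Ω)) (N : ℕ) (γ μ : ℝ) {D : ℝ}
    (hD : 0 ≤ D)
    (hlin : ∀ y ∈ dirichletDomain Ω, 0 ≤ weightedInner e N μ (linearPart ω e N γ y) y) :
    IsMonotoneFor (weightedInner e N μ) (closedLoopOp ω e N γ μ D) := by
  rintro y₁ y₂ _ ⟨hy₁, η₁, hη₁, rfl⟩ _ ⟨hy₂, η₂, hη₂, rfl⟩
  have h1 := hlin _ (sub_mem_dirichletDomain hy₁ hy₂)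
  have h2 := mul_nonneg hD (inner_sub_nonneg_of_mem_signH hη₁ hη₂)
  have heq : linearPart ω e N γ y₁ + chi ω (D • η₁) - (linearPart ω e N γ y₂ + chi ω (D • η₂)) =
      linearPart ω e N γ (y₁ - y₂) + D • chi ω (η₁ - η₂) := by
    simp only [linearPart_sub ω e N γ hy₁ hy₂, chi_smul, chi_sub, smul_sub]
    abel
  rw [weightedInner_eq] at h1 ⊢
  rw [heq, inner_add_left, real_inner_smul_left, inner_chi, weightOp_sub, chi_sub,
    ← weightOp_sub]
  exact add_nonneg h1 h2

theorem h1NormSq_nonneg (u : L2 Ω) : 0 ≤ h1NormSq u := by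
  unfold h1NormSq
  positivity

end HeatFeedback

end

theorem mainTheorem3 {n : ℕ} (Ω ω : TopologicalSpace.Opens (EuclideanSpace ℝ (Fin n)))
    (hω : (ω : Set (EuclideanSpace ℝ (Fin n))).Nonempty) (hωΩ : ω ≤ Ω)
    (e : HilbertBasis ℕ ℝ (HeatFeedback.L2 Ω)) (τ : ℕ → ℝ)
    (he : HeatFeedback.IsDirichletEigenbasis e τ)
    (Λ : ℝ) (hΛ : 0 < Λ) (C : ℝ) (hC : 0 < C)
    (hspec : HeatFeedback.IsSpectralConstant ω e (HeatFeedback.modeCount τ Λ) C)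
    (D : ℝ) (hD : 0 < D) :
    let N : ℕ := HeatFeedback.modeCount τ Λ
    let γ : ℝ := Λ / C
    let μ : ℝ := 1 / C ^ 2
    let c : ℝ := min (1 / 2)
      (min (Λ / C ^ 2 * (1 - Real.sqrt 2 / 2)) (Λ / 2 * (1 - Real.sqrt 2 / 2)))
    HeatFeedback.IsMonotoneFor (HeatFeedback.weightedInner e N μ)
        (HeatFeedback.closedLoopOp ω e N γ μ D) ∧
      0 < c ∧
      ∀ y ∈ HeatFeedback.dirichletDomain Ω,
        c * HeatFeedback.h1NormSq y ≤
          HeatFeedback.weightedInner e N μ (HeatFeedback.linearPart ω e N γ y) y := by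
  intro N γ μ c
  have hs : 0 < 1 - Real.sqrt 2 / 2 := by
    have : Real.sqrt 2 < 2 := by
      rw [Real.sqrt_lt' (by norm_num)]
      norm_num
    linarith
  have hc : 0 < c := lt_min (by norm_num) (lt_min (by positivity) (by positivity))
  have hcoercive : ∀ y ∈ HeatFeedback.dirichletDomain Ω,
      c * HeatFeedback.h1NormSq y ≤
        HeatFeedback.weightedInner e N μ (HeatFeedback.linearPart ω e N γ y) y := fun y hy =>
    HeatFeedback.coercive_linearPart hωΩ he hΛ hC
      (fun i hi => (HeatFeedback.lt_of_modeCount_le he.monotone he.tendsto hi).le) hspec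
      (min_le_left _ _) ((min_le_right _ _).trans (min_le_left _ _))
      ((min_le_right _ _).trans (min_le_right _ _)) hy
  exact ⟨HeatFeedback.isMonotoneFor_closedLoopOp ω e N γ μ hD.le fun y hy =>
    (mul_nonneg hc.le (HeatFeedback.h1NormSq_nonneg y)).trans (hcoercive y hy), hc, hcoercive⟩
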